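/- **Theorem.** *Setting.* Let $mc^2>0$, $r_e>0$, $E_0>0$, let $\mathbf s\in\mathbb R^3$ be a fixed source, let $\Omega\subset\mathbb R^3$ be open, and let the detectors be $\mathbf d=\mathbf d(\theta)$, $\theta\in\Theta$, with $\Theta\subset\mathbb R^2$ open and $\mathbf d:\Theta\to\mathbb R^3$ of class $C^\infty$ (for instance a local parametrisation of a detector surface $\mathbb D$). Assume that $\mathbf s,\mathbf d(\theta),\mathbf x$ are not collinear for all $\theta\in\Theta$, $\mathbf x\in\Omega$ (no degenerate tori). Let $n_e,\lambda_{PE}\in C^\infty(\mathbb R^3)$ be real valued (for instance functions in $C_c^\infty$ of some open set, extended by $0$). Put $$\kappa=\frac{\mathbf x-\mathbf s}{\|\mathbf x-\mathbf s\|}\cdot\frac{\mathbf d-\mathbf s}{\|\mathbf d-\mathbf s\|},\qquad \rho=\frac{\|\mathbf x-\mathbf s\|}{\|\mathbf d-\mathbf s\|},\qquad \phi(\mathbf x,\mathbf d,\mathbf s)=\frac{\kappa-\rho}{\sqrt{1-\kappa^2}},$$ $$\mu_E=E^{-3}\lambda_{PE}+\sigma(E)\,n_e,\qquad A_E(\mathbf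 a,\mathbf b)=\|\mathbf b-\mathbf a\|^{-2}\exp\Big(-\|\mathbf b-\mathbf a\|\int_0^1\mu_E(\mathbf a+t(\mathbf b-\mathbf a))\,dt\Big),$$ where $\sigma(E)$ is the total Klein–Nishina cross section, i.e. with $\alpha=E/mc^2$, $$\sigma(E)=2\pi r_e^2\Big\{\tfrac{1+\alpha}{\alpha^2}\Big[\tfrac{2(1+\alpha)}{1+2\alpha}-\tfrac{\ln(1+2\alpha)}{\alpha}\Big]+\tfrac{\ln(1+2\alpha)}{2\alpha}-\tfrac{1+3\alpha}{(1+2\alpha)^2}\Big\},$$ let $\omega\in(0,\pi)$ be given by $\cot\omega=\phi(\mathbf x,\mathbf d,\mathbf s)$, $E_\omega=E_0/\big(1+\tfrac{E_0}{mc^2}(1-\cos\omega)\big)$, and $$\mathcal W_1(n_e)(\mathbf x,\mathbf d,\mathbf s)=\|\nabla_{\mathbf x}\phi(\mathbf x,\mathbf d,\mathbf s)\|\,A_{E_0}(\mathbf s,\mathbf x)\,A_{E_\omega}(\mathbf x,\mathbf d),$$ $$\mathcal L_1(f,n_e)(p,\mathbf d,\mathbf s)=\int_\Omega \mathcal W_1(n_e)(\mathbf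 x,\mathbf d,\mathbf s)\,f(\mathbf x)\,\delta(p-\phi(\mathbf x,\mathbf d,\mathbf s))\,d\mathbf x .$$ Here $\int_\Omega h\,\delta(\gamma)\,d\mathbf x$ is the limit, required to exist and be the same for every $\eta\in C_c^\infty(\mathbb R)$ with $\int\eta=1$, of $\int_\Omega h(\mathbf x)\,\varepsilon^{-1}\eta(\gamma(\mathbf x)/\varepsilon)\,d\mathbf x$ as $\varepsilon\to0^+$. *Fourier integral operators.* For open $\Theta\subset\mathbb R^{m-1}$, $\Omega\subset\mathbb R^n$, a function $\Phi(p,\theta,\mathbf x,\sigma)=\sigma(p-\varphi(\mathbf x,\theta))$ is a phase function if it is $C^\infty$ on $\mathbb R\times\Theta\times\Omega\times(\mathbb R\setminus\{0\})$ and positively homogeneous of degree 1 in $\sigma$, neither $(\partial_{p,\theta}\Phi,\partial_\sigma\Phi)$ nor $(\partial_{\mathbf x}\Phi,\partial_\sigma\Phi)$ vanishes anywhere there, and $\partial_{p,\theta,\mathbf x}(\partial_\sigma\Phi)\ne0$ wherever $\partial_\sigma\Phi=0$. An amplitude of order $s_0$ is a function $a\in C^\infty(\mathbb R\times\Theta\times\Omega\times\mathbb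 R)$ such that on every compact $K\subset\mathbb R\times\Theta\times\Omega$ each partial derivative of $a$ with $j$ derivatives in $\sigma$ and any number in $(p,\theta,\mathbf x)$ is bounded by $C(1+|\sigma|)^{s_0-j}$ for all $\sigma\in\mathbb R$. An operator $F$ belongs to $I^{\,r}(\mathbb R\times\Theta,\Omega)$ if, for such a $\Phi$ and such an $a$ of order $s_0$ with $r=s_0-\frac{n+m-2}{4}$, $$Fu(p,\theta)=\int_{\mathbb R}\Big(\int_\Omega e^{i\Phi(p,\theta,\mathbf x,\sigma)}a(p,\theta,\mathbf x,\sigma)u(\mathbf x)\,d\mathbf x\Big)d\sigma\qquad(u\in C_c^\infty(\Omega),\ (p,\theta)\in\mathbb R\times\Theta),$$ the inner integral being integrable in $\sigma$. *Claim.* The integral defining $\mathcal L_1(f,n_e)(p,\mathbf d(\theta),\mathbf s)$ exists for all $f\in C_c^\infty(\Omega)$, $p\in\mathbb R$, $\theta\in\Theta$; the operator $f\mapsto\mathcal L_1(f,n_e)(p,\mathbf d(\theta),\mathbf s)$ is the Fourier integral operator with phase function $\sigma(p-\phi(\mathbf x,\mathbf d(\theta),\mathbf s))$ and amplitude $\frac1{2\pi}\mathcal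 W_1(n_e)(\mathbf x,\mathbf d(\theta),\mathbf s)$, which is of order $0$; hence it belongs to $I^{-1}(\mathbb R\times\Theta,\Omega)$, i.e. it is a Fourier integral operator of order $-1$. -/

import Mathlib

open scoped ContDiff Topology
open MeasureTheory Filter

noncomputable section

namespace ComptonFIO

/-- Euclidean space `ℝⁿ`. -/
abbrev E (n : ℕ) := EuclideanSpace ℝ (Fin n)

/-! ### Fourier integral operators with one frequency variable

The data space is `ℝ × Θ` with `Θ ⊆ ℝᵏ` open (so its dimension is `m = k + 1`), the object space is
an open set `Ω ⊆ ℝⁿ`, and the phases have the form `Φ(p, θ, x, σ) = σ (p - φ(x, θ))`. -/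

/-- `Φ(p, θ, x, σ) = σ (p - φ(x, θ))`. -/
def phase {k n : ℕ} (φ : E n → E k → ℝ) (p : ℝ) (θ : E k) (x : E n) (σ : ℝ) : ℝ :=
  σ * (p - φ x θ)

/-- `Φ(p, θ, x, σ) = σ (p - φ(x, θ))` is a (nondegenerate) phase function on
`ℝ × Θ × Ω × (ℝ ∖ {0})`. -/
structure IsPhaseFunction {k n : ℕ} (Θ : Set (E k)) (Ω : Set (E n)) (φ : E n → E k → ℝ) :
    Prop where
  smooth : ContDiffOn ℝ ∞
    (fun z : ℝ × E k × E n × ℝ => phase φ z.1 z.2.1 z.2.2.1 z.2.2.2)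
    (Set.univ ×ˢ Θ ×ˢ Ω ×ˢ {σ : ℝ | σ ≠ 0})
  homogeneous : ∀ p : ℝ, ∀ θ ∈ Θ, ∀ x ∈ Ω, ∀ σ : ℝ, σ ≠ 0 → ∀ r : ℝ, 0 < r →
    phase φ p θ x (r * σ) = r * phase φ p θ x σ
  /-- `(∂_{p,θ} Φ, ∂_σ Φ)` does not vanish. -/
  deriv_data_ne_zero : ∀ p : ℝ, ∀ θ ∈ Θ, ∀ x ∈ Ω, ∀ σ : ℝ, σ ≠ 0 →
    (fderiv ℝ (fun y : ℝ × E k => phase φ y.1 y.2 x σ) (p, θ),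
      deriv (fun τ : ℝ => phase φ p θ x τ) σ) ≠ 0
  /-- `(∂_x Φ, ∂_σ Φ)` does not vanish. -/
  deriv_object_ne_zero : ∀ p : ℝ, ∀ θ ∈ Θ, ∀ x ∈ Ω, ∀ σ : ℝ, σ ≠ 0 →
    (fderiv ℝ (fun x' : E n => phase φ p θ x' σ) x,
      deriv (fun τ : ℝ => phase φ p θ x τ) σ) ≠ 0
  /-- `∂_{p,θ,x} (∂_σ Φ)` does not vanish where `∂_σ Φ = 0`. -/
  nondegenerate : ∀ p : ℝ, ∀ θ ∈ Θ, ∀ x ∈ Ω, ∀ σ : ℝ, σ ≠ 0 →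
    deriv (fun τ : ℝ => phase φ p θ x τ) σ = 0 →
    fderiv ℝ (fun z : ℝ × E k × E n =>
      deriv (fun τ : ℝ => phase φ z.1 z.2.1 z.2.2 τ) σ) (p, θ, x) ≠ 0

/-- `a` is an amplitude (symbol) of order `s` on `ℝ × Θ × Ω × ℝ`: it is smooth, and each of its
partial derivatives, of order `j` in `σ` and of any order in `(p, θ, x)`, is bounded by
`C (1 + |σ|) ^ (s - j)`, locally uniformly in `(p, θ, x)`.  The partial derivatives of total order
`l` in `(p, θ, x)` are the coefficients of the `l`-th Fréchet derivative. -/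
structure IsAmplitude {k n : ℕ} (Θ : Set (E k)) (Ω : Set (E n)) (s : ℝ)
    (a : ℝ × E k × E n → ℝ → ℂ) : Prop where
  smooth : ContDiffOn ℝ ∞ (fun z : (ℝ × E k × E n) × ℝ => a z.1 z.2)
    ((Set.univ ×ˢ Θ ×ˢ Ω) ×ˢ Set.univ)
  bound : ∀ K : Set (ℝ × E k × E n), IsCompact K → K ⊆ Set.univ ×ˢ Θ ×ˢ Ω →
    ∀ j l : ℕ, ∃ C : ℝ, ∀ y ∈ K, ∀ σ : ℝ,
      ‖iteratedFDeriv ℝ l (fun y' => iteratedDeriv j (a y') σ) y‖ ≤ C * (1 + |σ|) ^ (s - j)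

/-- `u ∈ C_c^∞(Ω)`, complex valued. -/
structure IsTestFunction {n : ℕ} (Ω : Set (E n)) (u : E n → ℂ) : Prop where
  smooth : ContDiff ℝ ∞ u
  compact : HasCompactSupport u
  support_subset : tsupport u ⊆ Ω

/-- `F` is the Fourier integral operator with phase `Φ = σ (p - φ(x, θ))` and amplitude `a` of
order `s`: for `u ∈ C_c^∞(Ω)` and `(p, θ) ∈ ℝ × Θ`,
`F u (p, θ) = ∫_ℝ (∫_Ω e^{i Φ(p, θ, x, σ)} a(p, θ, x, σ) u(x) dx) dσ`,
where the inner integral is an integrable function of `σ`.  (The double integral need not converge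
absolutely; as `∂_x φ` vanishes nowhere for a phase function, the inner integral decreases rapidly,
and the iterated integral is the value of the oscillatory integral.) -/
structure IsFIOWith {k n : ℕ} (Θ : Set (E k)) (Ω : Set (E n)) (φ : E n → E k → ℝ)
    (a : ℝ × E k × E n → ℝ → ℂ) (s : ℝ) (F : (E n → ℂ) → ℝ → E k → ℂ) : Prop where
  isOpen_data : IsOpen Θ
  isOpen_object : IsOpen Ω
  isPhaseFunction : IsPhaseFunction Θ Ω φ
  isAmplitude : IsAmplitude Θ Ω s a
  integrable : ∀ u, IsTestFunction Ω u → ∀ p : ℝ, ∀ θ ∈ Θ,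
    Integrable (fun σ : ℝ => ∫ x in Ω,
      Complex.exp (Complex.I * (phase φ p θ x σ : ℂ)) * a (p, θ, x) σ * u x)
  eq_integral : ∀ u, IsTestFunction Ω u → ∀ p : ℝ, ∀ θ ∈ Θ,
    F u p θ = ∫ σ : ℝ, ∫ x in Ω,
      Complex.exp (Complex.I * (phase φ p θ x σ : ℂ)) * a (p, θ, x) σ * u x

/-- The class `I^r(ℝ × Θ, Ω)` of Fourier integral operators of order `r = s - (n + m - 2) / 4`,
where `m = k + 1` is the dimension of `ℝ × Θ` and `s` is the order of the amplitude. -/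
def fioClass {k n : ℕ} (r : ℝ) (Θ : Set (E k)) (Ω : Set (E n)) :
    Set ((E n → ℂ) → ℝ → E k → ℂ) :=
  {F | ∃ (φ : E n → E k → ℝ) (a : ℝ × E k × E n → ℝ → ℂ) (s : ℝ),
    IsFIOWith Θ Ω φ a s F ∧ r = s - ((n : ℝ) + ((k : ℝ) + 1) - 2) / 4}

/-! ### Integration against the Dirac distribution -/

/-- `∫_Ω h(x) δ(γ(x)) dx = v`: for every mollifier `η ∈ C_c^∞(ℝ)`, `∫ η = 1`, the integrals
`∫_Ω h(x) ε⁻¹ η(γ(x) / ε) dx` tend to `v` as `ε → 0⁺`. -/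
def HasDiracIntegral {n : ℕ} (Ω : Set (E n)) (γ : E n → ℝ) (h : E n → ℂ) (v : ℂ) : Prop :=
  ∀ η : ℝ → ℝ, ContDiff ℝ ∞ η → HasCompactSupport η → ∫ t, η t = 1 →
    Tendsto (fun ε : ℝ => ∫ x in Ω, h x * ((ε⁻¹ * η (γ x / ε) : ℝ) : ℂ)) (𝓝[>] 0) (𝓝 v)

/-- The value of a Dirac integral is unique. -/
theorem HasDiracIntegral.unique {n : ℕ} {Ω : Set (E n)} {γ : E n → ℝ} {h : E n → ℂ} {v w : ℂ}
    (hv : HasDiracIntegral Ω γ h v) (hw : HasDiracIntegral Ω γ h w) : v = w := by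
  let b : ContDiffBump (0 : ℝ) := ⟨1, 2, by norm_num, by norm_num⟩
  exact tendsto_nhds_unique
    (hv (b.normed volume) b.contDiff_normed b.hasCompactSupport_normed b.integral_normed)
    (hw (b.normed volume) b.contDiff_normed b.hasCompactSupport_normed b.integral_normed)

open Classical in
/-- `∫_Ω h(x) δ(γ(x)) dx` (and `0` if the integral does not exist). -/
def diracIntegral {n : ℕ} (Ω : Set (E n)) (γ : E n → ℝ) (h : E n → ℂ) : ℂ :=
  if hex : ∃ v, HasDiracIntegral Ω γ h v then hex.choose else 0

/-! ### The physical model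

`mc2` is the rest energy of the electron, `re` its classical radius, `E0` the energy of the
source, `ne` the electron density, `lamPE` the photoelectric factor. -/

/-- `κ(x, d, s)`, the cosine of the angle between `x - s` and `d - s`. -/
def kappa (x d s : E 3) : ℝ := inner ℝ (‖x - s‖⁻¹ • (x - s)) (‖d - s‖⁻¹ • (d - s))

/-- `ρ(x, d, s) = ‖x - s‖ / ‖d - s‖`. -/
def rho (x d s : E 3) : ℝ := ‖x - s‖ / ‖d - s‖

/-- The characteristic function `φ` of the spindle tori: off the line through `s` and `d`,
`φ(x, d, s) = cot ω` for the scattering angle `ω` at `x` (the angle between `x - s` and `d - x`). -/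
def torusPhi (x d s : E 3) : ℝ := (kappa x d s - rho x d s) / √(1 - kappa x d s ^ 2)

/-- The scattering angle `ω ∈ (0, π)` with `cot ω = p`. -/
def arccot (p : ℝ) : ℝ := Real.pi / 2 - Real.arctan p

/-- Compton formula: the energy after scattering with angle `om`. -/
def comptonEnergy (mc2 E0 om : ℝ) : ℝ := E0 / (1 + E0 / mc2 * (1 - Real.cos om))

/-- The total cross section of the Compton effect at energy `En` (Klein–Nishina formula), with
`α = En / mc2`. -/
def totalCrossSection (mc2 re En : ℝ) : ℝ :=
  let α := En / mc2
  2 * Real.pi * re ^ 2 *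
    ((1 + α) / α ^ 2 * (2 * (1 + α) / (1 + 2 * α) - Real.log (1 + 2 * α) / α)
      + Real.log (1 + 2 * α) / (2 * α) - (1 + 3 * α) / (1 + 2 * α) ^ 2)

/-- Lineic attenuation `μ_E(x) = E⁻³ λ_PE(x) + σ(E) n_e(x)`. -/
def attenuation (mc2 re : ℝ) (lamPE ne : E 3 → ℝ) (En : ℝ) (x : E 3) : ℝ :=
  (En ^ 3)⁻¹ * lamPE x + totalCrossSection mc2 re En * ne x

/-- `A_E(a, b) = ‖b - a‖⁻² exp (-‖b - a‖ ∫₀¹ μ_E(a + t (b - a)) dt)`: attenuation and photometric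
dispersion from `a` to `b`. -/
def beamFactor (mc2 re : ℝ) (lamPE ne : E 3 → ℝ) (En : ℝ) (a b : E 3) : ℝ :=
  (‖b - a‖ ^ 2)⁻¹ *
    Real.exp (-(‖b - a‖ * ∫ t in (0 : ℝ)..1, attenuation mc2 re lamPE ne En (a + t • (b - a))))

/-- `w₁(n_e)(x, d, s) = A_{E₀}(s, x) A_{E_ω}(x, d)` with `ω` the scattering angle at `x`. -/
def weight (mc2 re E0 : ℝ) (lamPE ne : E 3 → ℝ) (x d s : E 3) : ℝ :=
  beamFactor mc2 re lamPE ne E0 s x *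
    beamFactor mc2 re lamPE ne (comptonEnergy mc2 E0 (arccot (torusPhi x d s))) x d

/-- `𝒲₁(n_e)(x, d, s) = ‖∇_x φ(x, d, s)‖ w₁(n_e)(x, d, s)`. -/
def fullWeight (mc2 re E0 : ℝ) (lamPE ne : E 3 → ℝ) (x d s : E 3) : ℝ :=
  ‖gradient (fun x' => torusPhi x' d s) x‖ * weight mc2 re E0 lamPE ne x d s

/-- `ℒ₁(f, n_e)(p, d, s) = ∫_Ω 𝒲₁(n_e)(x, d, s) f(x) δ(p - φ(x, d, s)) dx`. -/
def L1 (mc2 re E0 : ℝ) (lamPE ne : E 3 → ℝ) (Ω : Set (E 3)) (f : E 3 → ℂ) (p : ℝ)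
    (d s : E 3) : ℂ :=
  diracIntegral Ω (fun x => p - torusPhi x d s)
    (fun x => (fullWeight mc2 re E0 lamPE ne x d s : ℂ) * f x)

end ComptonFIO

end

open ComptonFIO

noncomputable section

namespace ComptonFIO

universe u

/-! ### Smoothness of parametric integrals -/

/-! Fix `p`, `θ` and put `ψ = p - φ`, with `u = 𝒲₁ f`. Formally `δ(ψ) = (2π)⁻¹ ∫ e^{iσψ} dσ`, so
`ℒ₁` should have phase `σψ` and amplitude `𝒲₁ / (2π)`. To make this rigorous, Fourier inversion
turns the mollified integral into `(2π)⁻¹ ∫ g(εσ) I(σ) dσ`, where `I(σ) = ∫ e^{iσψ} u dx` and `g` is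
bounded and continuous with `g(0) = ∫ η = 1`. If `I` is integrable, dominated convergence gives the
limit `(2π)⁻¹ ∫ I`, whatever `η` is (`hasDiracIntegral_oscFactor`). Integrability of `I` is
non-stationary phase: `ψ` has no critical point, and two integrations by parts give `I = O((1 +
σ²)⁻¹)` (`integrable_integral_oscFactor`).

The geometric input is `fderiv_torusPhi_ne_zero`. On rays from the source `κ` is constant and `ρ` is
linear, so the radial derivative of `φ` is `-ρ / √(1 - κ²)`, which is nonzero; non-collinearity
gives `κ² < 1`. The same fact yields the phase conditions in `x` and the smoothness of `‖∇φ‖`. The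
other factors of `𝒲₁` are smooth because `s`, `x`, `d` are distinct and all energies are positive
(`contDiffAt_fullWeight`). As `𝒲₁` does not involve `σ`, the symbol estimates of order `0` reduce to
continuity on compact sets. -/

theorem contDiff_fderiv_left {H F : Type*} [NormedAddCommGroup H] [NormedSpace ℝ H]
    [NormedAddCommGroup F] [NormedSpace ℝ F] {f : H → ℝ → F}
    (hf : ContDiff ℝ ∞ (Function.uncurry f)) :
    ContDiff ℝ ∞ (Function.uncurry fun (x : H) (t : ℝ) => fderiv ℝ (fun x => f x t) x) := by
  refine ContDiff.fderiv (f := fun (z : H × ℝ) (x : H) => f x z.2) (n := ∞) ?_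
    contDiff_fst (m := ∞) (by simp)
  exact hf.comp (contDiff_snd.prodMk (contDiff_snd.comp contDiff_fst))

/-- Differentiation under the integral sign: the `x`-derivative is jointly continuous, hence bounded
on the compact set `closedBall x₀ 1 × [[a, b]]`, and this constant dominates. -/
theorem hasFDerivAt_intervalIntegral_of_contDiff {H F : Type*} [NormedAddCommGroup H]
    [NormedSpace ℝ H] [ProperSpace H] [NormedAddCommGroup F] [NormedSpace ℝ F]
    {f : H → ℝ → F} (hf : ContDiff ℝ ∞ (Function.uncurry f)) (a b : ℝ) (x₀ : H) :
    HasFDerivAt (fun x => ∫ t in a..b, f x t)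
      (∫ t in a..b, fderiv ℝ (fun x => f x t) x₀) x₀ := by
  have hf' : Continuous (Function.uncurry fun (x : H) (t : ℝ) => fderiv ℝ (fun x => f x t) x) :=
    (contDiff_fderiv_left hf).continuous
  have hfx : ∀ x, Continuous (f x) := fun x =>
    hf.continuous.comp (Continuous.prodMk_right x)
  obtain ⟨C, hC⟩ := ((isCompact_closedBall x₀ 1).prod
    (isCompact_uIcc (a := a) (b := b))).exists_bound_of_continuousOn hf'.continuousOn
  refine intervalIntegral.hasFDerivAt_integral_of_dominated_of_fderiv_le
    (F' := fun x t => fderiv ℝ (fun x => f x t) x) (bound := fun _ => C)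
    (Metric.closedBall_mem_nhds x₀ one_pos) ?_ ?_ ?_ ?_ ?_ ?_
  · exact Eventually.of_forall fun x => (hfx x).aestronglyMeasurable
  · exact (hfx x₀).intervalIntegrable _ _
  · exact (hf'.comp (Continuous.prodMk_right x₀)).aestronglyMeasurable
  · exact ae_of_all _ fun t ht x hx => hC (x, t) ⟨hx, Set.uIoc_subset_uIcc ht⟩
  · exact intervalIntegrable_const
  · refine ae_of_all _ fun t _ x _ => ?_
    have : ContDiff ℝ ∞ (fun x => f x t) := hf.comp (contDiff_id.prodMk contDiff_const)
    exact (this.differentiable (by simp) x).hasFDerivAt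

/-- The derivative is again a parametric integral of a smooth integrand, with values in `H →L[ℝ] F`.
The induction therefore runs over all `F`, and `H` and `F` share a universe so that `H →L[ℝ] F`
stays in it. -/
theorem contDiff_nat_intervalIntegral {H : Type u} [NormedAddCommGroup H] [NormedSpace ℝ H]
    [ProperSpace H] (a b : ℝ) (k : ℕ) : ∀ {F : Type u} [NormedAddCommGroup F] [NormedSpace ℝ F]
    {f : H → ℝ → F}, ContDiff ℝ ∞ (Function.uncurry f) →
    ContDiff ℝ k (fun x => ∫ t in a..b, f x t) := by
  induction k with
  | zero =>
    intro F _ _ f hf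
    have := fun x => (hasFDerivAt_intervalIntegral_of_contDiff hf a b x).continuousAt
    exact contDiff_zero.mpr (continuous_iff_continuousAt.mpr this)
  | succ k ih =>
    intro F _ _ f hf
    have key := hasFDerivAt_intervalIntegral_of_contDiff hf a b
    rw [Nat.cast_succ, contDiff_succ_iff_fderiv]
    refine ⟨fun x => (key x).differentiableAt, by simp, ?_⟩
    rw [funext fun x => (key x).fderiv]
    exact ih (contDiff_fderiv_left hf)

theorem contDiff_intervalIntegral {H F : Type u} [NormedAddCommGroup H] [NormedSpace ℝ H]
    [ProperSpace H] [NormedAddCommGroup F] [NormedSpace ℝ F]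
    {f : H → ℝ → F} (hf : ContDiff ℝ ∞ (Function.uncurry f)) (a b : ℝ) :
    ContDiff ℝ ∞ (fun x => ∫ t in a..b, f x t) :=
  contDiff_infty.mpr fun k => contDiff_nat_intervalIntegral a b k hf

/-! ### Test functions -/

namespace IsTestFunction

variable {n : ℕ} {Ω : Set (E n)} {u w : E n → ℂ}

theorem eventuallyEq_zero {x : E n} (hx : x ∉ tsupport u) : u =ᶠ[𝓝 x] 0 :=
  notMem_tsupport_iff_eventuallyEq.mp hx

theorem eq_zero (hu : IsTestFunction Ω u) {x : E n} (hx : x ∉ Ω) : u x = 0 :=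
  image_eq_zero_of_notMem_tsupport fun h => hx (hu.support_subset h)

theorem integrable (hu : IsTestFunction Ω u) : Integrable u :=
  hu.smooth.continuous.integrable_of_hasCompactSupport hu.compact

/-- The values of `g` outside `Ω` are irrelevant: off `tsupport u` the product vanishes locally. -/
theorem mul_left (hu : IsTestFunction Ω u) (hΩ : IsOpen Ω) {g : E n → ℂ}
    (hg : ContDiffOn ℝ ∞ g Ω) : IsTestFunction Ω (fun x => g x * u x) where
  smooth := by
    rw [contDiff_iff_contDiffAt]
    intro x
    by_cases hx : x ∈ tsupport u
    · exact (hg.contDiffAt (hΩ.mem_nhds (hu.support_subset hx))).mul hu.smooth.contDiffAt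
    · refine contDiffAt_const (c := (0 : ℂ)) |>.congr_of_eventuallyEq ?_
      filter_upwards [eventuallyEq_zero hx] with y hy
      simp [hy]
  compact := hu.compact.mul_left
  support_subset := (tsupport_mul_subset_right).trans hu.support_subset

theorem fderiv_apply (hu : IsTestFunction Ω u) (v : E n) :
    IsTestFunction Ω (fun x => fderiv ℝ u x v) where
  smooth := (hu.smooth.fderiv_right (m := ∞) (by simp)).clm_apply contDiff_const
  compact := hu.compact.fderiv_apply ℝ v
  support_subset := (tsupport_fderiv_apply_subset ℝ v).trans hu.support_subset

theorem zero : IsTestFunction Ω (fun _ => 0) where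
  smooth := contDiff_const
  compact := HasCompactSupport.zero
  support_subset := by simp [tsupport]

theorem add (hu : IsTestFunction Ω u) (hw : IsTestFunction Ω w) :
    IsTestFunction Ω (fun x => u x + w x) where
  smooth := hu.smooth.add hw.smooth
  compact := hu.compact.add hw.compact
  support_subset := (tsupport_add u w).trans (Set.union_subset hu.support_subset hw.support_subset)

theorem sum {ι : Type*} (t : Finset ι) {u : ι → E n → ℂ} (hu : ∀ i, IsTestFunction Ω (u i)) :
    IsTestFunction Ω (fun x => ∑ i ∈ t, u i x) := by
  classical
  induction t using Finset.induction_on with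
  | empty => simpa using zero
  | insert i t hi ih => simpa [Finset.sum_insert hi] using (hu i).add ih

theorem integral_fderiv_apply_eq_zero (hu : IsTestFunction Ω u) (v : E n) :
    ∫ x, fderiv ℝ u x v = 0 := by
  have := integral_mul_fderiv_eq_neg_fderiv_mul_of_integrable (μ := volume)
    (f := fun _ : E n => (1 : ℂ)) (g := u) (v := v) (by simp)
    (by simpa using (hu.fderiv_apply v).integrable) (by simpa using hu.integrable)
    (fun x _ => by fun_prop) (fun x _ => hu.smooth.differentiable (by simp) x)
  simpa using this

theorem setIntegral_mul_eq (hu : IsTestFunction Ω u) (e : E n → ℂ) :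
    ∫ x in Ω, e x * u x = ∫ x, e x * u x :=
  setIntegral_eq_integral_of_forall_compl_eq_zero fun x hx => by simp [hu.eq_zero hx]

end IsTestFunction

/-! ### Oscillatory integrals with a phase without critical points -/

section Oscillatory

variable {n : ℕ} {Ω : Set (E n)} {u : E n → ℂ} {ψ : E n → ℝ}

/-- The oscillating factor `e^{iσψ(x)}`. -/
def oscFactor (ψ : E n → ℝ) (σ : ℝ) (x : E n) : ℂ := Complex.exp (Complex.I * ((σ * ψ x : ℝ) : ℂ))

theorem norm_oscFactor (ψ : E n → ℝ) (σ : ℝ) (x : E n) : ‖oscFactor ψ σ x‖ = 1 := by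
  rw [oscFactor, mul_comm, Complex.norm_exp_ofReal_mul_I]

theorem contDiffOn_oscFactor (hψ : ContDiffOn ℝ ∞ ψ Ω) (σ : ℝ) :
    ContDiffOn ℝ ∞ (oscFactor ψ σ) Ω :=
  ContDiffOn.cexp (contDiffOn_const.mul
    (Complex.ofRealCLM.contDiff.comp_contDiffOn (contDiffOn_const.mul hψ)))

theorem hasFDerivAt_oscFactor {x : E n} (hψ : DifferentiableAt ℝ ψ x) (σ : ℝ) :
    HasFDerivAt (oscFactor ψ σ)
      ((Complex.I * σ * oscFactor ψ σ x) • (Complex.ofRealCLM.comp (fderiv ℝ ψ x))) x := by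
  have h1 : HasFDerivAt (fun x => ((σ * ψ x : ℝ) : ℂ))
      (Complex.ofRealCLM.comp (σ • fderiv ℝ ψ x)) x :=
    Complex.ofRealCLM.hasFDerivAt.comp x (hψ.hasFDerivAt.const_mul σ)
  refine (h1.const_mul Complex.I).cexp.congr_fderiv ?_
  ext v
  simp [oscFactor]
  ring

theorem continuous_oscFactor_left (ψ : E n → ℝ) (x : E n) :
    Continuous fun σ => oscFactor ψ σ x := by
  unfold oscFactor
  fun_prop

/-- The directional derivative of the test function `e^{iσψ} u` has integral zero; expand it by the
product rule. -/
theorem integral_oscFactor_mul_fderiv (hΩ : IsOpen Ω) (hψ : ContDiffOn ℝ ∞ ψ Ω)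
    (hu : IsTestFunction Ω u) (v : E n) (σ : ℝ) :
    Complex.I * σ * ∫ x, oscFactor ψ σ x * ((fderiv ℝ ψ x v : ℂ) * u x) =
      -∫ x, oscFactor ψ σ x * fderiv ℝ u x v := by
  have he := contDiffOn_oscFactor hψ σ
  have hdψ : ContDiffOn ℝ ∞ (fun x => (fderiv ℝ ψ x v : ℂ)) Ω :=
    Complex.ofRealCLM.contDiff.comp_contDiffOn
      ((hψ.fderiv_of_isOpen hΩ (by simp)).clm_apply contDiffOn_const)
  have h0 := (hu.mul_left hΩ he).integral_fderiv_apply_eq_zero v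
  have h1 : ∀ x, fderiv ℝ (fun x => oscFactor ψ σ x * u x) x v =
      Complex.I * σ * (oscFactor ψ σ x * ((fderiv ℝ ψ x v : ℂ) * u x)) +
        oscFactor ψ σ x * fderiv ℝ u x v := by
    intro x
    by_cases hx : x ∈ tsupport u
    · have hxΩ := hΩ.mem_nhds (hu.support_subset hx)
      have := (hasFDerivAt_oscFactor ((hψ.contDiffAt hxΩ).differentiableAt (by simp)) σ).mul
        (hu.smooth.differentiable (by simp) x).hasFDerivAt
      rw [show (fun x => oscFactor ψ σ x * u x) = oscFactor ψ σ * u from rfl, this.fderiv]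
      simp
      ring
    · have h2 : (fun x => oscFactor ψ σ x * u x) =ᶠ[𝓝 x] fun _ => 0 := by
        filter_upwards [IsTestFunction.eventuallyEq_zero hx] with y hy
        simp [hy]
      rw [h2.fderiv_eq, (IsTestFunction.eventuallyEq_zero hx).fderiv_eq,
        (IsTestFunction.eventuallyEq_zero hx).eq_of_nhds]
      simp
  simp_rw [h1] at h0
  rw [integral_add, integral_const_mul] at h0
  · exact eq_neg_of_add_eq_zero_left h0
  · exact ((((hu.mul_left hΩ hdψ).mul_left hΩ he).integrable).const_mul _)
  · exact ((hu.fderiv_apply v).mul_left hΩ he).integrable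

/-- Integration by parts along `∇ψ / |∇ψ|²`, in which `ψ` grows at unit rate. -/
theorem exists_integral_oscFactor_eq (hΩ : IsOpen Ω) (hψ : ContDiffOn ℝ ∞ ψ Ω)
    (hψ' : ∀ x ∈ Ω, fderiv ℝ ψ x ≠ 0) (hu : IsTestFunction Ω u) :
    ∃ w, IsTestFunction Ω w ∧ ∀ σ : ℝ,
      Complex.I * σ * ∫ x, oscFactor ψ σ x * u x = ∫ x, oscFactor ψ σ x * w x := by
  let b := EuclideanSpace.basisFun (Fin n) ℝ
  let N : E n → ℝ := fun x => ∑ j, fderiv ℝ ψ x (b j) ^ 2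
  have hd : ∀ j, ContDiffOn ℝ ∞ (fun x => fderiv ℝ ψ x (b j)) Ω := fun j =>
    (hψ.fderiv_of_isOpen hΩ (by simp)).clm_apply contDiffOn_const
  have hN : ∀ x ∈ Ω, N x ≠ 0 := by
    intro x hx h0
    apply hψ' x hx
    have := (Finset.sum_eq_zero_iff_of_nonneg fun j _ => sq_nonneg _).mp h0
    refine ContinuousLinearMap.coe_injective (b.toBasis.ext fun j => ?_)
    simpa using this j (Finset.mem_univ j)
  have hc : ∀ j, ContDiffOn ℝ ∞ (fun x => ((fderiv ℝ ψ x (b j) / N x : ℝ) : ℂ)) Ω := fun j =>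
    Complex.ofRealCLM.contDiff.comp_contDiffOn
      ((hd j).div (ContDiffOn.sum fun i _ => (hd i).pow 2) hN)
  have hw := fun j => hu.mul_left hΩ (hc j)
  have hdC : ∀ j, ContDiffOn ℝ ∞ (fun x => (fderiv ℝ ψ x (b j) : ℂ)) Ω := fun j =>
    Complex.ofRealCLM.contDiff.comp_contDiffOn (hd j)
  -- The witness is `-div (u ∇ψ / |∇ψ|²)`, the transposed vector field applied to `u`.
  refine ⟨fun x => ∑ j, -1 * fderiv ℝ (fun x => ((fderiv ℝ ψ x (b j) / N x : ℝ) : ℂ) * u x) x (b j),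
    IsTestFunction.sum _ fun j => ((hw j).fderiv_apply (b j)).mul_left hΩ contDiffOn_const,
    fun σ => ?_⟩
  have he := contDiffOn_oscFactor hψ σ
  -- Since `∑ (∂ⱼψ)² / N = 1` on `Ω`, `u` splits into terms `∂ⱼψ · (…)`, each ready for integration
  -- by parts in direction `j`.
  have h1 : ∀ x, oscFactor ψ σ x * u x = ∑ j, oscFactor ψ σ x *
      ((fderiv ℝ ψ x (b j) : ℂ) * (((fderiv ℝ ψ x (b j) / N x : ℝ) : ℂ) * u x)) := by
    intro x
    by_cases hx : x ∈ Ω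
    · have h2 : ∑ j, fderiv ℝ ψ x (b j) * (fderiv ℝ ψ x (b j) / N x) = 1 := by
        rw [← div_self (hN x hx)]
        simp only [N, Finset.sum_div]
        exact Finset.sum_congr rfl fun j _ => by ring
      have h3 : ∑ j, (fderiv ℝ ψ x (b j) : ℂ) * ((fderiv ℝ ψ x (b j) / N x : ℝ) : ℂ) = 1 := by
        exact_mod_cast h2
      calc oscFactor ψ σ x * u x = oscFactor ψ σ x * (1 * u x) := by rw [one_mul]
        _ = _ := by
          rw [← h3, Finset.sum_mul, Finset.mul_sum]
          exact Finset.sum_congr rfl fun j _ => by ring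
    · simp [hu.eq_zero hx]
  simp_rw [h1]
  rw [integral_finsetSum _ fun j _ =>
    (((hw j).mul_left hΩ (hdC j)).mul_left hΩ he).integrable, Finset.mul_sum]
  simp_rw [Finset.mul_sum]
  rw [integral_finsetSum _ fun j _ =>
    ((((hw j).fderiv_apply (b j)).mul_left hΩ contDiffOn_const).mul_left hΩ he).integrable]
  refine Finset.sum_congr rfl fun j _ => ?_
  rw [integral_oscFactor_mul_fderiv hΩ hψ (hw j) (b j) σ, ← integral_neg]
  congr 1 with x
  ring

theorem norm_integral_oscFactor_le (ψ : E n → ℝ) (u : E n → ℂ) (σ : ℝ) :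
    ‖∫ x, oscFactor ψ σ x * u x‖ ≤ ∫ x, ‖u x‖ := by
  refine (norm_integral_le_integral_norm _).trans_eq ?_
  simp [norm_oscFactor]

theorem continuous_integral_oscFactor (hΩ : IsOpen Ω) (hψ : ContDiffOn ℝ ∞ ψ Ω)
    (hu : IsTestFunction Ω u) : Continuous fun σ : ℝ => ∫ x, oscFactor ψ σ x * u x := by
  refine continuous_of_dominated (bound := fun x => ‖u x‖) (fun σ =>
    (hu.mul_left hΩ (contDiffOn_oscFactor hψ σ)).smooth.continuous.aestronglyMeasurable)
    (fun σ => ae_of_all _ fun x => ?_) hu.integrable.norm (ae_of_all _ fun x => ?_)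
  · simp [norm_oscFactor]
  · exact (continuous_oscFactor_left ψ x).mul continuous_const

/-- One integration by parts yields only a bound `O(1/|σ|)`; two give `σ² |I(σ)| ≤ ‖w₂‖₁`. Adding
the trivial bound `|I(σ)| ≤ ‖u‖₁` controls `(1 + σ²) |I(σ)|`, also near `σ = 0`. -/
theorem integrable_integral_oscFactor (hΩ : IsOpen Ω) (hψ : ContDiffOn ℝ ∞ ψ Ω)
    (hψ' : ∀ x ∈ Ω, fderiv ℝ ψ x ≠ 0) (hu : IsTestFunction Ω u) :
    Integrable fun σ : ℝ => ∫ x, oscFactor ψ σ x * u x := by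
  obtain ⟨w₁, hw₁, h₁⟩ := exists_integral_oscFactor_eq hΩ hψ hψ' hu
  obtain ⟨w₂, hw₂, h₂⟩ := exists_integral_oscFactor_eq hΩ hψ hψ' hw₁
  refine (integrable_inv_one_add_sq.const_mul ((∫ x, ‖u x‖) + ∫ x, ‖w₂ x‖)).mono'
    (continuous_integral_oscFactor hΩ hψ hu).aestronglyMeasurable (ae_of_all _ fun σ => ?_)
  have h3 : ‖∫ x, oscFactor ψ σ x * u x‖ * σ ^ 2 ≤ ∫ x, ‖w₂ x‖ := by
    refine le_of_eq_of_le ?_ (norm_integral_oscFactor_le ψ w₂ σ)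
    rw [← h₂, ← h₁]
    simp only [norm_mul, Complex.norm_I, Complex.norm_real, Real.norm_eq_abs]
    rw [← sq_abs σ]
    ring
  rw [← div_eq_mul_inv, le_div_iff₀ (by positivity), mul_add, mul_one]
  exact add_le_add (norm_integral_oscFactor_le ψ u σ) h3

end Oscillatory

/-! ### Dirac integrals as oscillatory integrals -/

open scoped FourierTransform in
/-- Fourier inversion for a mollifier. -/
theorem exists_fourier_representation {η : ℝ → ℝ} (hη : ContDiff ℝ ∞ η)
    (hηc : HasCompactSupport η) (hη1 : ∫ t, η t = 1) :
    ∃ g : ℝ → ℂ, Continuous g ∧ Integrable g ∧ (∃ C, ∀ w, ‖g w‖ ≤ C) ∧ g 0 = 1 ∧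
      ∀ t, (η t : ℂ) =
        (2 * Real.pi : ℂ)⁻¹ * ∫ w, Complex.exp (Complex.I * ((w * t : ℝ) : ℂ)) * g w := by
  have hpi : (2 * Real.pi) ≠ 0 := by positivity
  let f : SchwartzMap ℝ ℂ := HasCompactSupport.toSchwartzMap
    (f := fun t => (η t : ℂ)) (hηc.comp_left (g := fun r : ℝ => (r : ℂ)) rfl)
    (Complex.ofRealCLM.contDiff.comp hη)
  have hf : ∀ t, f t = (η t : ℂ) := fun t => rfl
  have hinv : ∀ t, f t =
      ∫ w, Complex.exp (Complex.I * ((2 * Real.pi * w * t : ℝ) : ℂ)) * 𝓕 f w := by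
    intro t
    have h := congrFun (f.continuous.fourierInv_fourier_eq f.integrable (𝓕 f).integrable) t
    rw [Real.fourierInv_eq'] at h
    rw [← h]
    refine integral_congr_ae (ae_of_all _ fun w => ?_)
    simp only [smul_eq_mul, SchwartzMap.fourier_coe]
    congr 2
    simp
    ring
  -- `𝓕` uses the kernel `e^{-2πiwt}`; rescaling the frequency moves the `2π` from the exponent to
  -- the prefactor.
  refine ⟨fun w => 𝓕 f ((2 * Real.pi)⁻¹ * w), by fun_prop, ?_, ?_, ?_, fun t => ?_⟩
  · exact (𝓕 f).integrable.comp_mul_left' (inv_ne_zero hpi)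
  · exact ⟨_, fun w => (𝓕 f).toBoundedContinuousFunction.norm_coe_le_norm _⟩
  · simp only [mul_zero]
    rw [SchwartzMap.fourier_coe, Real.fourier_eq']
    simp [hf, integral_complex_ofReal, hη1]
  · rw [← hf, hinv]
    have := Measure.integral_comp_mul_left
      (fun w => Complex.exp (Complex.I * ((2 * Real.pi * w * t : ℝ) : ℂ)) * 𝓕 f w)
      ((2 * Real.pi)⁻¹)
    rw [inv_inv, abs_of_pos (by positivity)] at this
    rw [eq_inv_mul_iff_mul_eq₀ (by exact_mod_cast hpi)]
    rw [Complex.real_smul] at this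
    push_cast at this ⊢
    rw [← this]
    refine integral_congr_ae (ae_of_all _ fun w => ?_)
    simp only
    congr 3
    field_simp

section Dirac

variable {n : ℕ} {Ω : Set (E n)} {u : E n → ℂ} {ψ : E n → ℝ}

/-- A Dirac integral, mollified at scale `ε`, as an oscillatory integral. -/
theorem integral_mollifier_eq (hΩ : IsOpen Ω) (hψ : ContinuousOn ψ Ω) (hu : IsTestFunction Ω u)
    {η : ℝ → ℝ} {g : ℝ → ℂ} (hgi : Integrable g)
    (hg : ∀ t, (η t : ℂ) =
      (2 * Real.pi : ℂ)⁻¹ * ∫ w, Complex.exp (Complex.I * ((w * t : ℝ) : ℂ)) * g w)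
    {ε : ℝ} (hε : 0 < ε) :
    ∫ x in Ω, u x * ((ε⁻¹ * η (ψ x / ε) : ℝ) : ℂ) =
      (2 * Real.pi : ℂ)⁻¹ * ∫ σ : ℝ, g (ε * σ) * ∫ x, oscFactor ψ σ x * u x := by
  have h1 : ∀ x, ((ε⁻¹ * η (ψ x / ε) : ℝ) : ℂ) =
      (2 * Real.pi : ℂ)⁻¹ * ∫ σ : ℝ, oscFactor ψ σ x * g (ε * σ) := by
    intro x
    have := Measure.integral_comp_mul_left
      (fun w => Complex.exp (Complex.I * ((w * (ψ x / ε) : ℝ) : ℂ)) * g w) ε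
    rw [abs_of_pos (by positivity), Complex.real_smul] at this
    rw [Complex.ofReal_mul, hg, mul_left_comm, ← this]
    congr 2 with σ
    rw [oscFactor, show ε * σ * (ψ x / ε) = σ * ψ x by field_simp]
  have hgε : Integrable (fun σ => g (ε * σ)) := hgi.comp_mul_left' hε.ne'
  simp_rw [h1]
  simp_rw [← hu.setIntegral_mul_eq (oscFactor ψ _)]
  have h2 : ∀ x, u x * ((2 * Real.pi : ℂ)⁻¹ * ∫ σ : ℝ, oscFactor ψ σ x * g (ε * σ)) =
      (2 * Real.pi : ℂ)⁻¹ * ∫ σ : ℝ, g (ε * σ) * (oscFactor ψ σ x * u x) := by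
    intro x
    rw [mul_left_comm, ← integral_const_mul]
    congr 2 with σ
    ring
  simp_rw [h2, integral_const_mul]
  -- Fubini applies because `g(ε ·)` is integrable: the integrand is a factor of modulus `1` times
  -- the integrable product `u(x) g(εσ)`.
  rw [integral_integral_swap]
  · simp_rw [integral_const_mul]
  · have hm : AEStronglyMeasurable (fun z : E n × ℝ => oscFactor ψ z.2 z.1)
        ((volume.restrict Ω).prod volume) := by
      have h3 : AEStronglyMeasurable (fun z : E n × ℝ => ψ z.1)
          ((volume.restrict Ω).prod volume) :=
        (hψ.aestronglyMeasurable hΩ.measurableSet).comp_fst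
      have h4 : AEStronglyMeasurable (fun z : E n × ℝ => z.2)
          ((volume.restrict Ω).prod volume) := continuous_snd.aestronglyMeasurable
      have h5 : Continuous fun r : ℝ => Complex.exp (Complex.I * (r : ℂ)) := by fun_prop
      exact h5.comp_aestronglyMeasurable (h4.mul h3)
    have hi := (hu.integrable.restrict (s := Ω)).mul_prod hgε
    refine (hi.bdd_mul (c := 1) hm (ae_of_all _ fun z => (norm_oscFactor _ _ _).le)).congr
      (ae_of_all _ fun z => ?_)
    simp only [Function.uncurry]
    ring

theorem hasDiracIntegral_oscFactor (hΩ : IsOpen Ω) (hψ : ContDiffOn ℝ ∞ ψ Ω)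
    (hψ' : ∀ x ∈ Ω, fderiv ℝ ψ x ≠ 0) (hu : IsTestFunction Ω u) :
    HasDiracIntegral Ω ψ u ((2 * Real.pi : ℂ)⁻¹ * ∫ σ : ℝ, ∫ x, oscFactor ψ σ x * u x) := by
  intro η hη hηc hη1
  obtain ⟨g, hgc, hgi, ⟨C, hC⟩, hg0, hg⟩ := exists_fourier_representation hη hηc hη1
  have hH := integrable_integral_oscFactor hΩ hψ hψ' hu
  have h1 : Tendsto (fun ε : ℝ => (2 * Real.pi : ℂ)⁻¹ *
      ∫ σ : ℝ, g (ε * σ) * ∫ x, oscFactor ψ σ x * u x) (𝓝[>] 0)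
      (𝓝 ((2 * Real.pi : ℂ)⁻¹ * ∫ σ : ℝ, ∫ x, oscFactor ψ σ x * u x)) := by
    refine Tendsto.const_mul _ (tendsto_integral_filter_of_dominated_convergence
      (fun σ => C * ‖∫ x, oscFactor ψ σ x * u x‖) ?_ ?_ (hH.norm.const_mul C) ?_)
    · exact Eventually.of_forall fun ε =>
        (hgc.comp (continuous_const.mul continuous_id)).aestronglyMeasurable.mul
          hH.aestronglyMeasurable
    · refine Eventually.of_forall fun ε => ae_of_all _ fun σ => ?_
      rw [norm_mul]
      exact mul_le_mul_of_nonneg_right (hC _) (norm_nonneg _)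
    · refine ae_of_all _ fun σ => ?_
      have h2 : Tendsto (fun ε : ℝ => g (ε * σ)) (𝓝[>] 0) (𝓝 1) := by
        have : Continuous fun ε : ℝ => g (ε * σ) := by fun_prop
        simpa [hg0] using (this.tendsto 0).mono_left nhdsWithin_le_nhds
      simpa using h2.mul_const (∫ x, oscFactor ψ σ x * u x)
  refine h1.congr' ?_
  filter_upwards [self_mem_nhdsWithin] with ε hε
  exact (integral_mollifier_eq hΩ hψ.continuousOn hu hgi hg hε).symm

theorem HasDiracIntegral.diracIntegral_eq {h : E n → ℂ} {v : ℂ} (hv : HasDiracIntegral Ω ψ h v) :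
    diracIntegral Ω ψ h = v := by
  have hex : ∃ v, HasDiracIntegral Ω ψ h v := ⟨v, hv⟩
  rw [diracIntegral, dif_pos hex]
  exact hex.choose_spec.unique hv

end Dirac

/-! ### The characteristic function of the spindle tori -/

section Torus

variable {x d s : E 3}

theorem ne_of_not_collinear (h : ¬ Collinear ℝ {s, d, x}) : s ≠ d ∧ s ≠ x ∧ d ≠ x := by
  refine ⟨?_, ?_, ?_⟩ <;> rintro rfl <;> apply h
  · simpa using collinear_pair ℝ s x
  · rw [Set.pair_comm d s, Set.insert_eq_of_mem (by simp)]
    exact collinear_pair ℝ s d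
  · simpa using collinear_pair ℝ s d

theorem kappa_eq (x d s : E 3) :
    kappa x d s = inner ℝ (x - s) (d - s) / (‖x - s‖ * ‖d - s‖) := by
  rw [kappa, real_inner_smul_left, real_inner_smul_right]
  field_simp

/-- Strict Cauchy–Schwarz: equality would make `d - s` a multiple of `x - s`. -/
theorem one_sub_kappa_sq_pos (h : ¬ Collinear ℝ {s, d, x}) : 0 < 1 - kappa x d s ^ 2 := by
  rw [sub_pos, sq_lt_one_iff_abs_lt_one, kappa_eq]
  refine lt_of_le_of_ne (abs_real_inner_div_norm_mul_norm_le_one _ _) fun h1 => h ?_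
  obtain ⟨-, r, -, hr⟩ := (abs_real_inner_div_norm_mul_norm_eq_one_iff _ _).mp h1
  rw [collinear_iff_of_mem (p₀ := s) (by simp)]
  refine ⟨x - s, ?_⟩
  rintro p (rfl | rfl | rfl)
  · exact ⟨0, by simp⟩
  · exact ⟨r, by simp [← hr]⟩
  · exact ⟨1, by simp⟩

theorem contDiffAt_torusPhi (h : ¬ Collinear ℝ {s, d, x}) :
    ContDiffAt ℝ ∞ (fun z : E 3 × E 3 => torusPhi z.1 z.2 s) (x, d) := by
  obtain ⟨hsd, hsx, -⟩ := ne_of_not_collinear h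
  have hx : ContDiffAt ℝ ∞ (fun z : E 3 × E 3 => z.1 - s) (x, d) := by fun_prop
  have hd : ContDiffAt ℝ ∞ (fun z : E 3 × E 3 => z.2 - s) (x, d) := by fun_prop
  have hnx := hx.norm ℝ (sub_ne_zero.mpr hsx.symm)
  have hnd := hd.norm ℝ (sub_ne_zero.mpr hsd.symm)
  have hnx0 : ‖x - s‖ ≠ 0 := norm_ne_zero_iff.mpr (sub_ne_zero.mpr hsx.symm)
  have hnd0 : ‖d - s‖ ≠ 0 := norm_ne_zero_iff.mpr (sub_ne_zero.mpr hsd.symm)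
  have hk : ContDiffAt ℝ ∞ (fun z : E 3 × E 3 => kappa z.1 z.2 s) (x, d) :=
    ((hnx.inv hnx0).smul hx).inner ℝ ((hnd.inv hnd0).smul hd)
  have hpos := one_sub_kappa_sq_pos h
  exact (hk.sub (hnx.div hnd hnd0)).div ((contDiffAt_const.sub (hk.pow 2)).sqrt hpos.ne')
    (Real.sqrt_pos.mpr hpos).ne'

theorem kappa_add_smul {r : ℝ} (hr : 0 < r) :
    kappa (s + r • (x - s)) d s = kappa x d s := by
  rw [kappa_eq, kappa_eq, add_sub_cancel_left, norm_smul, real_inner_smul_left,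
    Real.norm_of_nonneg hr.le, mul_assoc, mul_div_mul_left _ _ hr.ne']

theorem rho_add_smul {r : ℝ} (hr : 0 < r) : rho (s + r • (x - s)) d s = r * rho x d s := by
  rw [rho, rho, add_sub_cancel_left, norm_smul, Real.norm_of_nonneg hr.le, mul_div_assoc]

/-- On a ray from the source, `κ` is constant and `ρ` is linear, so `φ` is strictly decreasing. -/
theorem fderiv_torusPhi_apply (h : ¬ Collinear ℝ {s, d, x}) :
    fderiv ℝ (fun x' => torusPhi x' d s) x (x - s) = -(rho x d s / √(1 - kappa x d s ^ 2)) := by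
  have h0 : DifferentiableAt ℝ (fun x' => torusPhi x' d s) x :=
    ((contDiffAt_torusPhi h).comp x (contDiffAt_id.prodMk contDiffAt_const)).differentiableAt
      (by simp)
  have h1 : HasDerivAt (fun r : ℝ => s + r • (x - s)) (x - s) 1 := by
    simpa using ((hasDerivAt_id (1 : ℝ)).smul_const (x - s)).const_add s
  have h2 : HasDerivAt (fun r : ℝ => torusPhi (s + r • (x - s)) d s)
      (fderiv ℝ (fun x' => torusPhi x' d s) x (x - s)) 1 := by
    have h3 : s + (1 : ℝ) • (x - s) = x := by simp
    exact HasFDerivAt.comp_hasDerivAt (1 : ℝ) (l := fun x' => torusPhi x' d s)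
      (by rw [h3]; exact h0.hasFDerivAt) h1
  have h4 : HasDerivAt
      (fun r : ℝ => (kappa x d s - r * rho x d s) / √(1 - kappa x d s ^ 2))
      (-(rho x d s / √(1 - kappa x d s ^ 2))) 1 := by
    have := (((hasDerivAt_id (1 : ℝ)).mul_const (rho x d s)).const_sub (kappa x d s)).div_const
      (√(1 - kappa x d s ^ 2))
    simpa [neg_div] using this
  refine h2.unique (h4.congr_of_eventuallyEq ?_)
  -- The scaling rules for `κ` and `ρ` need `r > 0`, which holds near `r = 1`.
  filter_upwards [lt_mem_nhds (one_pos (α := ℝ))] with r hr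
  rw [torusPhi, kappa_add_smul hr, rho_add_smul hr]

theorem fderiv_torusPhi_ne_zero (h : ¬ Collinear ℝ {s, d, x}) :
    fderiv ℝ (fun x' => torusPhi x' d s) x ≠ 0 := by
  intro h0
  obtain ⟨hsd, hsx, -⟩ := ne_of_not_collinear h
  have h1 := fderiv_torusPhi_apply h
  rw [h0, zero_apply, eq_comm, neg_eq_zero] at h1
  have h2 : 0 < rho x d s / √(1 - kappa x d s ^ 2) :=
    div_pos (div_pos (norm_sub_pos_iff.mpr hsx.symm) (norm_sub_pos_iff.mpr hsd.symm))
      (Real.sqrt_pos.mpr (one_sub_kappa_sq_pos h))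
  exact h2.ne' h1

theorem norm_gradient_eq_sqrt {n : ℕ} (f : E n → ℝ) (x : E n) :
    ‖gradient f x‖ = √(∑ i, fderiv ℝ f x (EuclideanSpace.basisFun (Fin n) ℝ i) ^ 2) := by
  rw [← Real.sqrt_sq (norm_nonneg (gradient f x)),
    ← (EuclideanSpace.basisFun (Fin n) ℝ).sum_sq_norm_inner_left]
  simp [gradient]

/-- A norm is smooth only away from zero, so this rests on `φ` having no critical points. -/
theorem contDiffAt_norm_gradient_torusPhi (h : ¬ Collinear ℝ {s, d, x}) :
    ContDiffAt ℝ ∞ (fun z : E 3 × E 3 => ‖gradient (fun x' => torusPhi x' z.2 s) z.1‖) (x, d) := by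
  have h1 : ContDiffAt ℝ ∞
      (fun z : E 3 × E 3 => fderiv ℝ (fun x' => torusPhi x' z.2 s) z.1) (x, d) := by
    refine ContDiffAt.fderiv (f := fun (z : E 3 × E 3) (x' : E 3) => torusPhi x' z.2 s) (n := ∞)
      ?_ contDiffAt_fst (by simp)
    exact ContDiffAt.comp ((x, d), x) (g := fun z : E 3 × E 3 => torusPhi z.1 z.2 s)
      (f := fun z : (E 3 × E 3) × E 3 => (z.2, z.1.2)) (contDiffAt_torusPhi h)
      (contDiffAt_snd.prodMk (contDiffAt_snd.comp _ contDiffAt_fst))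
  simp_rw [norm_gradient_eq_sqrt]
  refine ContDiffAt.sqrt (ContDiffAt.sum fun i _ => (h1.clm_apply contDiffAt_const).pow 2) ?_
  rw [← Real.sqrt_ne_zero (Finset.sum_nonneg fun i _ => sq_nonneg _), ← norm_gradient_eq_sqrt,
    norm_ne_zero_iff, gradient]
  simpa using fderiv_torusPhi_ne_zero h

end Torus

/-! ### Smoothness of the weight -/

section Weight

variable {mc2 re E0 : ℝ} {lamPE ne : E 3 → ℝ}

theorem comptonEnergy_den_pos (hmc2 : 0 < mc2) (hE0 : 0 < E0) (om : ℝ) :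
    0 < 1 + E0 / mc2 * (1 - Real.cos om) := by
  have := mul_nonneg (div_pos hE0 hmc2).le (sub_nonneg.mpr (Real.cos_le_one om))
  linarith

theorem comptonEnergy_pos (hmc2 : 0 < mc2) (hE0 : 0 < E0) (om : ℝ) :
    0 < comptonEnergy mc2 E0 om :=
  div_pos hE0 (comptonEnergy_den_pos hmc2 hE0 om)

theorem contDiff_comptonEnergy_arccot (hmc2 : 0 < mc2) (hE0 : 0 < E0) :
    ContDiff ℝ ∞ fun p => comptonEnergy mc2 E0 (arccot p) := by
  have h1 : ContDiff ℝ ∞ arccot := contDiff_const.sub Real.contDiff_arctan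
  exact contDiff_const.div (contDiff_const.add
    (contDiff_const.mul (contDiff_const.sub (Real.contDiff_cos.comp h1))))
    fun p => (comptonEnergy_den_pos hmc2 hE0 _).ne'

theorem contDiffAt_totalCrossSection (hmc2 : 0 < mc2) (re : ℝ) {En : ℝ} (hEn : 0 < En) :
    ContDiffAt ℝ ∞ (totalCrossSection mc2 re) En := by
  have hα : ContDiffAt ℝ ∞ (fun En : ℝ => En / mc2) En := contDiffAt_id.div_const _
  have hα0 : 0 < En / mc2 := div_pos hEn hmc2
  have h1 : 1 + 2 * (En / mc2) ≠ 0 := by positivity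
  have h2 : En / mc2 ≠ 0 := hα0.ne'
  have h3 : (En / mc2) ^ 2 ≠ 0 := by positivity
  have h4 : (1 + 2 * (En / mc2)) ^ 2 ≠ 0 := by positivity
  have h5 : 2 * (En / mc2) ≠ 0 := by positivity
  unfold totalCrossSection
  fun_prop (disch := assumption)

theorem contDiff_lineIntegral {q : E 3 → ℝ} (hq : ContDiff ℝ ∞ q) :
    ContDiff ℝ ∞ fun z : E 3 × E 3 => ∫ t in (0 : ℝ)..1, q (z.1 + t • (z.2 - z.1)) := by
  refine contDiff_intervalIntegral (f := fun (z : E 3 × E 3) t => q (z.1 + t • (z.2 - z.1))) ?_ 0 1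
  exact hq.comp (by fun_prop)

/-- Separates the energy, in which smoothness is established only at positive values, from the line
integrals, which are smooth in the endpoints everywhere. -/
theorem integral_attenuation (mc2 re : ℝ) (hne : Continuous ne) (hlamPE : Continuous lamPE)
    (En : ℝ) (a b : E 3) :
    ∫ t in (0 : ℝ)..1, attenuation mc2 re lamPE ne En (a + t • (b - a)) =
      (En ^ 3)⁻¹ * (∫ t in (0 : ℝ)..1, lamPE (a + t • (b - a))) +
        totalCrossSection mc2 re En * ∫ t in (0 : ℝ)..1, ne (a + t • (b - a)) := by
  simp only [attenuation]
  rw [intervalIntegral.integral_add, intervalIntegral.integral_const_mul,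
    intervalIntegral.integral_const_mul]
  all_goals exact Continuous.intervalIntegrable (by fun_prop) _ _

/-- Energy and endpoints depend on a common parameter, to cover both `A_{E₀}(s, x)` and `A_{E_ω}(x,
d)`, where `E_ω` varies with `x` and `d`. -/
theorem contDiffAt_beamFactor (hmc2 : 0 < mc2) (re : ℝ) (hne : ContDiff ℝ ∞ ne)
    (hlamPE : ContDiff ℝ ∞ lamPE) {X : Type*} [NormedAddCommGroup X] [NormedSpace ℝ X]
    {En : X → ℝ} {a b : X → E 3} {z : X} (hEn : ContDiffAt ℝ ∞ En z) (ha : ContDiffAt ℝ ∞ a z)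
    (hb : ContDiffAt ℝ ∞ b z) (hpos : 0 < En z) (hab : a z ≠ b z) :
    ContDiffAt ℝ ∞ (fun z => beamFactor mc2 re lamPE ne (En z) (a z) (b z)) z := by
  have hn : ContDiffAt ℝ ∞ (fun z => ‖b z - a z‖) z :=
    (hb.sub ha).norm ℝ (sub_ne_zero.mpr hab.symm)
  have hn0 : ‖b z - a z‖ ^ 2 ≠ 0 :=
    pow_ne_zero 2 (norm_ne_zero_iff.mpr (sub_ne_zero.mpr hab.symm))
  have hl : ∀ {q : E 3 → ℝ}, ContDiff ℝ ∞ q →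
      ContDiffAt ℝ ∞ (fun z => ∫ t in (0 : ℝ)..1, q (a z + t • (b z - a z))) z := fun hq =>
    ContDiffAt.comp z (contDiff_lineIntegral hq).contDiffAt (ha.prodMk hb)
  have hσ : ContDiffAt ℝ ∞ (fun z => totalCrossSection mc2 re (En z)) z :=
    ContDiffAt.comp z (g := totalCrossSection mc2 re)
      (contDiffAt_totalCrossSection hmc2 re hpos) hEn
  simp only [beamFactor, integral_attenuation mc2 re hne.continuous hlamPE.continuous]
  exact ((hn.pow 2).inv hn0).mul (hn.mul ((((hEn.pow 3).inv (pow_ne_zero 3 hpos.ne')).mul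
    (hl hlamPE)).add (hσ.mul (hl hne)))).neg.exp

theorem contDiffAt_fullWeight (hmc2 : 0 < mc2) (re : ℝ) (hE0 : 0 < E0) (hne : ContDiff ℝ ∞ ne)
    (hlamPE : ContDiff ℝ ∞ lamPE) {x d s : E 3} (h : ¬ Collinear ℝ {s, d, x}) :
    ContDiffAt ℝ ∞ (fun z : E 3 × E 3 => fullWeight mc2 re E0 lamPE ne z.1 z.2 s) (x, d) := by
  obtain ⟨hsd, hsx, hdx⟩ := ne_of_not_collinear h
  have hE : ContDiffAt ℝ ∞
      (fun z : E 3 × E 3 => comptonEnergy mc2 E0 (arccot (torusPhi z.1 z.2 s))) (x, d) :=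
    ContDiffAt.comp (x, d) (g := fun p => comptonEnergy mc2 E0 (arccot p))
      (contDiff_comptonEnergy_arccot hmc2 hE0).contDiffAt
      (contDiffAt_torusPhi h)
  exact (contDiffAt_norm_gradient_torusPhi h).mul
    ((contDiffAt_beamFactor hmc2 re hne hlamPE contDiffAt_const contDiffAt_const contDiffAt_fst
      hE0 hsx).mul
    (contDiffAt_beamFactor hmc2 re hne hlamPE hE contDiffAt_fst contDiffAt_snd
      (comptonEnergy_pos hmc2 hE0 _) hdx.symm))

end Weight

/-! ### Phase functions and amplitudes -/

section PhaseAndAmplitude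

variable {k n : ℕ} {Θ : Set (E k)} {Ω : Set (E n)} {φ : E n → E k → ℝ}

theorem deriv_phase (φ : E n → E k → ℝ) (p : ℝ) (θ : E k) (x : E n) (σ : ℝ) :
    deriv (fun τ : ℝ => phase φ p θ x τ) σ = p - φ x θ := by
  simp [phase]

/-- The nonvanishing conditions come from `∂_p Φ = σ`, `∂_x Φ = -σ ∂_x φ` and `∂_p ∂_σ Φ = 1`; only
the second uses `hφ'`. -/
theorem isPhaseFunction_of_contDiffAt
    (hφ : ∀ x ∈ Ω, ∀ θ ∈ Θ, ContDiffAt ℝ ∞ (fun z : E n × E k => φ z.1 z.2) (x, θ))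
    (hφ' : ∀ x ∈ Ω, ∀ θ ∈ Θ, fderiv ℝ (fun x' => φ x' θ) x ≠ 0) : IsPhaseFunction Θ Ω φ where
  smooth := by
    rintro ⟨p, θ, x, σ⟩ ⟨-, hθ, hx, -⟩
    have h1 : ContDiffAt ℝ ∞ (fun z : ℝ × E k × E n × ℝ => φ z.2.2.1 z.2.1) (p, θ, x, σ) :=
      ContDiffAt.comp (p, θ, x, σ) (g := fun z : E n × E k => φ z.1 z.2)
        (f := fun z : ℝ × E k × E n × ℝ => (z.2.2.1, z.2.1)) (hφ x hx θ hθ) (by fun_prop)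
    have h2 : ContDiffAt ℝ ∞ (fun z : ℝ × E k × E n × ℝ => z.2.2.2) (p, θ, x, σ) := by fun_prop
    exact (h2.mul (contDiffAt_fst.sub h1)).contDiffWithinAt
  homogeneous p θ _ x _ σ _ r _ := by
    simp only [phase]
    ring
  deriv_data_ne_zero p θ hθ x hx σ hσ h := by
    have h0 : fderiv ℝ (fun y : ℝ × E k => phase φ y.1 y.2 x σ) (p, θ) = 0 := (Prod.mk.inj h).1
    have h1 : HasFDerivAt (fun y : ℝ × E k => phase φ y.1 y.2 x σ) _ (p, θ) :=
      (hasFDerivAt_fst.sub ((hφ x hx θ hθ).comp (p, θ)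
        (f := fun y : ℝ × E k => (x, y.2)) (by fun_prop)
        |>.differentiableAt (by simp)).hasFDerivAt).const_mul σ
    have h2 : HasDerivAt (fun q : ℝ => phase φ q θ x σ)
        (fderiv ℝ (fun y : ℝ × E k => phase φ y.1 y.2 x σ) (p, θ) (1, 0)) p :=
      HasFDerivAt.comp_hasDerivAt p (l := fun y : ℝ × E k => phase φ y.1 y.2 x σ)
        h1.differentiableAt.hasFDerivAt
        ((hasDerivAt_id p).prodMk (hasDerivAt_const p θ))
    have h3 : HasDerivAt (fun q : ℝ => phase φ q θ x σ) (σ * 1) p :=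
      ((hasDerivAt_id p).sub_const (φ x θ)).const_mul σ
    rw [h0] at h2
    exact hσ (by simpa using h3.unique h2)
  deriv_object_ne_zero p θ hθ x hx σ hσ h := by
    have h0 : fderiv ℝ (fun x' : E n => phase φ p θ x' σ) x = 0 := (Prod.mk.inj h).1
    have h1 : DifferentiableAt ℝ (fun x' => φ x' θ) x :=
      ((hφ x hx θ hθ).comp x (f := fun x' => (x', θ)) (by fun_prop)).differentiableAt (by simp)
    have h2 : HasFDerivAt (fun x' : E n => phase φ p θ x' σ)
        (σ • -fderiv ℝ (fun x' => φ x' θ) x) x := (h1.hasFDerivAt.const_sub p).const_mul σ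
    rw [h2.fderiv, smul_neg, neg_eq_zero, smul_eq_zero] at h0
    exact h0.elim hσ (hφ' x hx θ hθ)
  nondegenerate p θ hθ x hx σ _ _ h := by
    simp_rw [deriv_phase] at h
    have h1 : DifferentiableAt ℝ (fun z : ℝ × E k × E n => z.1 - φ z.2.2 z.2.1) (p, θ, x) :=
      differentiableAt_fst.sub (((hφ x hx θ hθ).comp (p, θ, x)
        (f := fun z : ℝ × E k × E n => (z.2.2, z.2.1)) (by fun_prop)).differentiableAt (by simp))
    have h2 : HasDerivAt (fun q : ℝ => q - φ x θ)
        (fderiv ℝ (fun z : ℝ × E k × E n => z.1 - φ z.2.2 z.2.1) (p, θ, x) (1, 0, 0)) p :=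
      HasFDerivAt.comp_hasDerivAt p (l := fun z : ℝ × E k × E n => z.1 - φ z.2.2 z.2.1)
        h1.hasFDerivAt
        ((hasDerivAt_id p).prodMk ((hasDerivAt_const p θ).prodMk (hasDerivAt_const p x)))
    have h3 := (hasDerivAt_id p).sub_const (φ x θ)
    rw [h] at h2
    simpa using h3.unique h2

/-- A smooth function that does not depend on the frequency is an amplitude of order `0`. -/
theorem isAmplitude_of_contDiffOn (hΘ : IsOpen Θ) (hΩ : IsOpen Ω) {c : ℝ × E k × E n → ℂ}
    (hc : ContDiffOn ℝ ∞ c (Set.univ ×ˢ Θ ×ˢ Ω)) : IsAmplitude Θ Ω 0 fun y _ => c y where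
  smooth := hc.comp contDiffOn_fst fun _ hz => hz.1
  bound K hK hKU j l := by
    -- For `j = 0` the weight `(1 + |σ|) ^ 0` is `1` and compactness of `K` suffices; for `j > 0`
    -- the `σ`-derivative vanishes and `C = 0` works.
    rcases Nat.eq_zero_or_pos j with rfl | hj
    · have hU : IsOpen ((Set.univ : Set ℝ) ×ˢ Θ ×ˢ Ω) := isOpen_univ.prod (hΘ.prod hΩ)
      have h1 : ContinuousOn (iteratedFDeriv ℝ l c) K := by
        refine ContinuousOn.mono ?_ hKU
        refine (hc.continuousOn_iteratedFDerivWithin (m := l) (by exact_mod_cast le_top)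
          hU.uniqueDiffOn).congr fun y hy => ?_
        exact (iteratedFDerivWithin_of_isOpen l hU hy).symm
      obtain ⟨C, hC⟩ := hK.exists_bound_of_continuousOn h1
      exact ⟨C, fun y hy σ => by simpa using hC y hy⟩
    · refine ⟨0, fun y _ σ => ?_⟩
      simp [iteratedDeriv_const, hj.ne']

end PhaseAndAmplitude

end ComptonFIO

end

theorem theorem3p4
    -- physical constants: rest energy and classical radius of the electron, energy of the source
    (mc2 re E0 : ℝ) (hmc2 : 0 < mc2) (hre : 0 < re) (hE0 : 0 < E0)
    -- electron density and photoelectric factor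
    (ne lamPE : E 3 → ℝ) (hne : ContDiff ℝ ∞ ne) (hlamPE : ContDiff ℝ ∞ lamPE)
    -- the source, the object domain, and the detector surface, parametrised by `Θ ⊆ ℝ²`
    (s : E 3) (Ω : Set (E 3)) (hΩ : IsOpen Ω)
    (Θ : Set (E 2)) (hΘ : IsOpen Θ) (d : E 2 → E 3) (hd : ContDiffOn ℝ ∞ d Θ)
    -- the degenerate tori are excluded
    (hcol : ∀ θ ∈ Θ, ∀ x ∈ Ω, ¬ Collinear ℝ {s, d θ, x}) :
    -- the Dirac integral that defines `ℒ₁(f, n_e)` exists,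
    (∀ f, IsTestFunction Ω f → ∀ p : ℝ, ∀ θ ∈ Θ,
      HasDiracIntegral Ω (fun x => p - torusPhi x (d θ) s)
        (fun x => (fullWeight mc2 re E0 lamPE ne x (d θ) s : ℂ) * f x)
        (L1 mc2 re E0 lamPE ne Ω f p (d θ) s)) ∧
    -- `ℒ₁(·, n_e)` has the phase `σ (p - φ(x, d, s))` and an amplitude `𝒲₁ / (2π)` of order `0`,
    IsFIOWith Θ Ω (fun x θ => torusPhi x (d θ) s)
      (fun y _ => ((2 * Real.pi)⁻¹ * fullWeight mc2 re E0 lamPE ne y.2.2 (d y.2.1) s : ℝ)) 0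
      (fun f p θ => L1 mc2 re E0 lamPE ne Ω f p (d θ) s) ∧
    -- and is a Fourier integral operator of order `-1`
    (fun f p θ => L1 mc2 re E0 lamPE ne Ω f p (d θ) s) ∈ fioClass (-1) Θ Ω := by

  have hφ : ∀ x ∈ Ω, ∀ θ ∈ Θ,
      ContDiffAt ℝ ∞ (fun z : E 3 × E 2 => torusPhi z.1 (d z.2) s) (x, θ) := fun x hx θ hθ =>
    ContDiffAt.comp (x, θ) (g := fun z : E 3 × E 3 => torusPhi z.1 z.2 s)
      (f := fun z : E 3 × E 2 => (z.1, d z.2)) (contDiffAt_torusPhi (hcol θ hθ x hx))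
      (contDiffAt_fst.prodMk ((hd.contDiffAt (hΘ.mem_nhds hθ)).comp (x, θ) contDiffAt_snd))
  have hφ' : ∀ x ∈ Ω, ∀ θ ∈ Θ, fderiv ℝ (fun x' => torusPhi x' (d θ) s) x ≠ 0 :=
    fun x hx θ hθ => fderiv_torusPhi_ne_zero (hcol θ hθ x hx)
  have hW : ∀ x ∈ Ω, ∀ θ ∈ Θ,
      ContDiffAt ℝ ∞ (fun z : E 3 × E 2 => fullWeight mc2 re E0 lamPE ne z.1 (d z.2) s) (x, θ) :=
    fun x hx θ hθ => ContDiffAt.comp (x, θ)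
      (g := fun z : E 3 × E 3 => fullWeight mc2 re E0 lamPE ne z.1 z.2 s)
      (f := fun z : E 3 × E 2 => (z.1, d z.2))
      (contDiffAt_fullWeight hmc2 re hE0 hne hlamPE (hcol θ hθ x hx))
      (contDiffAt_fst.prodMk ((hd.contDiffAt (hΘ.mem_nhds hθ)).comp (x, θ) contDiffAt_snd))
  have hψ : ∀ p : ℝ, ∀ θ ∈ Θ, ContDiffOn ℝ ∞ (fun x => p - torusPhi x (d θ) s) Ω :=
    fun p θ hθ x hx => (contDiffAt_const.sub ((hφ x hx θ hθ).comp x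
      (f := fun x' => (x', θ)) (by fun_prop))).contDiffWithinAt
  have hψ' : ∀ p : ℝ, ∀ θ ∈ Θ, ∀ x ∈ Ω, fderiv ℝ (fun x => p - torusPhi x (d θ) s) x ≠ 0 := by
    intro p θ hθ x hx
    rw [fderiv_const_sub, neg_ne_zero]
    exact hφ' x hx θ hθ
  have hu : ∀ f, IsTestFunction Ω f → ∀ θ ∈ Θ, IsTestFunction Ω
      (fun x => (fullWeight mc2 re E0 lamPE ne x (d θ) s : ℂ) * f x) := fun f hf θ hθ =>
    hf.mul_left hΩ fun x hx => (Complex.ofRealCLM.contDiff.contDiffAt.comp x ((hW x hx θ hθ).comp x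
      (f := fun x' => (x', θ)) (by fun_prop))).contDiffWithinAt
  have hdirac := fun f (hf : IsTestFunction Ω f) (p : ℝ) θ (hθ : θ ∈ Θ) =>
    hasDiracIntegral_oscFactor hΩ (hψ p θ hθ) (hψ' p θ hθ) (hu f hf θ hθ)
  have hL := fun f (hf : IsTestFunction Ω f) (p : ℝ) θ (hθ : θ ∈ Θ) =>
    (hdirac f hf p θ hθ).diracIntegral_eq
  -- Moving `(2π)⁻¹` out of the amplitude identifies the inner integral of the operator with the one
  -- in the Dirac formula.
  have hinner : ∀ f, IsTestFunction Ω f → ∀ p : ℝ, ∀ θ ∈ Θ, ∀ σ : ℝ,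
      ∫ x in Ω, Complex.exp (Complex.I *
          (phase (fun x θ => torusPhi x (d θ) s) p θ x σ : ℂ)) *
        (((2 * Real.pi)⁻¹ * fullWeight mc2 re E0 lamPE ne x (d θ) s : ℝ) : ℂ) * f x =
      (2 * Real.pi : ℂ)⁻¹ * ∫ x, oscFactor (fun x => p - torusPhi x (d θ) s) σ x *
        ((fullWeight mc2 re E0 lamPE ne x (d θ) s : ℂ) * f x) := by
    intro f hf p θ hθ σ
    rw [← (hu f hf θ hθ).setIntegral_mul_eq, ← integral_const_mul]
    congr 1 with x
    simp only [oscFactor, phase]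
    push_cast
    ring
  have hfio : IsFIOWith Θ Ω (fun x θ => torusPhi x (d θ) s)
      (fun y _ => ((2 * Real.pi)⁻¹ * fullWeight mc2 re E0 lamPE ne y.2.2 (d y.2.1) s : ℝ)) 0
      (fun f p θ => L1 mc2 re E0 lamPE ne Ω f p (d θ) s) :=
    { isOpen_data := hΘ
      isOpen_object := hΩ
      isPhaseFunction := isPhaseFunction_of_contDiffAt hφ hφ'
      isAmplitude := by
        refine isAmplitude_of_contDiffOn hΘ hΩ (c := fun y =>
          (((2 * Real.pi)⁻¹ * fullWeight mc2 re E0 lamPE ne y.2.2 (d y.2.1) s : ℝ) : ℂ)) ?_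
        rintro ⟨p, θ, x⟩ ⟨-, hθ, hx⟩
        have h1 := (hW x hx θ hθ).comp (p, θ, x)
          (f := fun y : ℝ × E 2 × E 3 => (y.2.2, y.2.1)) (by fun_prop)
        exact (Complex.ofRealCLM.contDiff.contDiffAt.comp (p, θ, x)
          (contDiffAt_const.mul h1)).contDiffWithinAt
      integrable := fun f hf p θ hθ => by
        simp_rw [hinner f hf p θ hθ]
        exact (integrable_integral_oscFactor hΩ (hψ p θ hθ) (hψ' p θ hθ)
          (hu f hf θ hθ)).const_mul _
      eq_integral := fun f hf p θ hθ => by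
        simp_rw [hinner f hf p θ hθ]
        rw [integral_const_mul]
        exact hL f hf p θ hθ }
  -- With `n = 3` and `m = 2 + 1`, the order is `0 - (3 + 3 - 2) / 4 = -1`.
  refine ⟨fun f hf p θ hθ => ?_, hfio, _, _, 0, hfio, by norm_num⟩
  rw [L1, hL f hf p θ hθ]
  exact hdirac f hf p θ hθ
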